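/- Let $N$ voters choose between two alternatives $A$ and $B$. The state $\omega\in\{a,b\}$ equals $a$ with prior probability $\pi\in(0,1)$. Each voter $i$ privately learns her type $(p_i,q_i)\in\{A,B,I\}\times[1/2,1]$, where $p_i\sim P_i$ and $q_i\sim Q_i$ are independent, types are independent across voters and of $\omega$, and $P_i$, $Q_i$ are arbitrary commonly known probability distributions (with or without atoms). She then receives a signal $s_i\in\{a,b\}$ with $\Pr(s_i=\omega\mid\omega,q_i)=q_i$; signals are independent across voters conditionally on the state and the types. Simultaneously, each voter votes for $A$, votes for $B$, abstains, or delegates to another voter. Delegation is transitive; the vote of a voter whose chain of delegations ends with an abstention or leads into a delegation cycle is cast in abstention. The alternative with more votes cast wins, and ties are broken by a fair coin. A voter with $p_i=A$ (resp. $p_i=B$) has payoff $1$ if $A$ (resp. $B$) wins and $0$ otherwise; a voter with $p_i=I$ has payoff $1$ if the outcome matches the state ($A$ in $a$, $B$ in $b$) and $0$ otherwise. A (pure) strategy of voter $i$ is a measurable map from (type, signal) to actions, and voters maximise ex-ante expected payoff. A strategy of voter $i$ is weakly dominated if some strategy of hers, possibly a finite mixture of pure strategies, yields her at least as much against every profile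 of strategies of the others and strictly more against some profile. It is a threshold strategy if partisan types vote for their preferred alternative and, for each signal, there are a strict ordering $y_0,\dots,y_{N+1}$ of the $N+2$ actions of voter $i$ and thresholds $1/2\le\tau_0\le\dots\le\tau_N\le 1$ such that independent types with precision below $\tau_0$ take $y_0$, those with precision strictly between $\tau_{k-1}$ and $\tau_k$ take $y_k$ $(1\le k\le N)$, those above $\tau_N$ take $y_{N+1}$, and a type exactly at a threshold takes one of the actions of the pieces meeting there. Then the game has a pure-strategy Bayes–Nash equilibrium (against all unilateral deviations to arbitrary strategies) in which every voter uses a threshold strategy and no voter's strategy is weakly dominated. -/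

import Mathlib

open MeasureTheory

noncomputable section

namespace LiquidDemocracy

/-- The two sides. The same type is used for the alternatives `A`, `B`, for the states of the world
`a`, `b` (in state `a` the correct alternative is `A`), and for the signals `a`, `b`. -/
inductive Alt : Type
  | A
  | B
  deriving DecidableEq

instance : Fintype Alt where
  elems := {Alt.A, Alt.B}
  complete := fun v => by cases v <;> simp

/-- The opposite alternative. -/
def Alt.other : Alt → Alt
  | .A => .B
  | .B => .A

abbrev State := Alt

abbrev Signal := Alt

/-- Preferences: a partisan of an alternative, or independent. -/
inductive Pref : Type
  | partisan (v : Alt)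
  | independent

instance : MeasurableSpace Pref := ⊤

/-- Information precisions: the interval `[1/2, 1]`. -/
abbrev Precision : Type := Set.Icc (1 / 2 : ℝ) 1

/-- A type of a voter: a preference together with a precision. -/
abbrev VoterType : Type := Pref × Precision

/-- The actions of voter `i`: vote for an alternative, abstain, or delegate to another voter. -/
inductive Action {N : ℕ} (i : Fin N) : Type
  | vote (v : Alt)
  | abstain
  | delegate (j : Fin N) (hj : j ≠ i)

instance {N : ℕ} (i : Fin N) : MeasurableSpace (Action i) := ⊤

/-- `CastsFor c i v`: under the action profile `c`, the vote of voter `i` is finally cast for `v`,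
either directly or at the end of a (transitive) chain of delegations. The votes of a voter who
abstains, who is on a delegation cycle, or whose chain of delegations leads to an abstention or to
a cycle, are cast for neither alternative. -/
inductive CastsFor {N : ℕ} (c : ∀ i : Fin N, Action i) : Fin N → Alt → Prop
  | direct {i : Fin N} {v : Alt} (h : c i = Action.vote v) : CastsFor c i v
  | delegated {i j : Fin N} {v : Alt} (hj : j ≠ i) (h : c i = Action.delegate j hj)
      (hv : CastsFor c j v) : CastsFor c i v

/-- The number of votes cast for `v`. -/
def voteCount {N : ℕ} (c : ∀ i : Fin N, Action i) (v : Alt) : ℕ :=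
  Set.ncard {i : Fin N | CastsFor c i v}

/-- The probability that `v` wins: simple majority of the votes cast, with a fair coin for ties. -/
def winProb {N : ℕ} (c : ∀ i : Fin N, Action i) (v : Alt) : ℝ :=
  if voteCount c v.other < voteCount c v then 1
  else if voteCount c v = voteCount c v.other then 1 / 2
  else 0

/-- Ex-post payoff of a voter with preference `p` when `o` is elected in state `ω`. -/
def payoff (p : Pref) (o : Alt) (ω : State) : ℝ :=
  match p with
  | .partisan v => if o = v then 1 else 0
  | .independent => if o = ω then 1 else 0

/-- The probability of signal `s` in state `ω` for a voter with precision `q`. -/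
def signalProb (q : Precision) (ω : State) (s : Signal) : ℝ :=
  if s = ω then (q : ℝ) else 1 - (q : ℝ)

/-- The primitives of the game with `N` voters: the prior probability of state `a` and, for each
voter, the distributions of her preference and of her precision. -/
structure Environment (N : ℕ) where
  prior : ℝ
  prior_mem : prior ∈ Set.Ioo (0 : ℝ) 1
  prefLaw : Fin N → ProbabilityMeasure Pref
  precLaw : Fin N → ProbabilityMeasure Precision

/-- The prior probability of a state. -/
def Environment.stateProb {N : ℕ} (E : Environment N) : State → ℝ
  | .A => E.prior
  | .B => 1 - E.prior

/-- The law of the type profile: types are independent across voters, and each voter's preference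
and precision are independent. -/
def Environment.typeLaw {N : ℕ} (E : Environment N) : Measure (Fin N → VoterType) :=
  Measure.pi fun i => (E.prefLaw i : Measure Pref).prod (E.precLaw i : Measure Precision)

/-- Expected utility of voter `i` when the type profile is `t` and the profile of interim
strategies is `σ`; the signals are independent conditionally on the state and the types. -/
def interimUtility {N : ℕ} (E : Environment N) (σ : ∀ i : Fin N, Signal → Action i)
    (t : Fin N → VoterType) (i : Fin N) : ℝ :=
  ∑ ω : State, E.stateProb ω * ∑ s : Fin N → Signal, (∏ j, signalProb (t j).2 ω (s j)) *
    ∑ o : Alt, winProb (fun j => σ j (s j)) o * payoff (t i).1 o ω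

/-- A (pure) ex-ante strategy of voter `i`: a measurable contingent plan choosing an action for
every type and every signal of hers. -/
structure ExAnteStrategy {N : ℕ} (i : Fin N) where
  act : VoterType → Signal → Action i
  measurable_act : ∀ s, Measurable fun t => act t s

/-- Profiles of ex-ante strategies. -/
abbrev StrategyProfile (N : ℕ) := ∀ i : Fin N, ExAnteStrategy i

/-- Ex-ante expected utility of voter `i`. -/
def expectedUtility {N : ℕ} (E : Environment N) (S : StrategyProfile N) (i : Fin N) : ℝ :=
  ∫ t, interimUtility E (fun j => (S j).act (t j)) t i ∂E.typeLaw

/-- Bayes-Nash equilibrium in ex-ante strategies, with unrestricted deviations. -/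
def IsBayesNash {N : ℕ} (E : Environment N) (S : StrategyProfile N) : Prop :=
  ∀ (i : Fin N) (D : ExAnteStrategy i),
    expectedUtility E (Function.update S i D) i ≤ expectedUtility E S i

/-- `D` is weakly dominated for voter `i`: some mixture of finitely many strategies of voter `i`
(in particular, possibly, a single pure strategy) does at least as well as `D` against every
profile of the other voters, and strictly better against some profile. The component `S i` of the
quantified profile is overwritten, so that only the strategies of the others matter. -/
def IsWeaklyDominated {N : ℕ} (E : Environment N) (i : Fin N) (D : ExAnteStrategy i) : Prop :=
  ∃ (m : ℕ) (w : Fin m → ℝ) (D' : Fin m → ExAnteStrategy i),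
    (∀ k, 0 ≤ w k) ∧ ∑ k, w k = 1 ∧
    (∀ S : StrategyProfile N, expectedUtility E (Function.update S i D) i ≤
      ∑ k, w k * expectedUtility E (Function.update S i (D' k)) i) ∧
    (∃ S : StrategyProfile N, expectedUtility E (Function.update S i D) i <
      ∑ k, w k * expectedUtility E (Function.update S i (D' k)) i)

/-- A Bayes-Nash equilibrium in which no voter uses a weakly dominated strategy. -/
def IsUndominatedEquilibrium {N : ℕ} (E : Environment N) (S : StrategyProfile N) : Prop :=
  IsBayesNash E S ∧ ∀ i, ¬ IsWeaklyDominated E i (S i)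

/-- Threshold strategies of voter `i`. Partisan types vote for their preferred alternative. For
independent types there are, for each signal, a strict ordering `r` of the `N + 2` actions of
voter `i` and `N + 1` thresholds `τ 0 ≤ … ≤ τ N` in `[1/2, 1]`, such that types strictly between
two consecutive thresholds take the corresponding action of the ordering: `r 0` below `τ 0`, then
`r k` between `τ (k - 1)` and `τ k`, then `r (N + 1)` above `τ N`. A type that is exactly at a
threshold takes the action of one of the pieces that meet there. -/
def IsThreshold {N : ℕ} {i : Fin N} (D : ExAnteStrategy i) : Prop :=
  (∀ (v : Alt) (q : Precision) (s : Signal), D.act (Pref.partisan v, q) s = Action.vote v) ∧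
  ∀ s : Signal, ∃ (r : Fin (N + 2) ≃ Action i) (τ : Fin (N + 1) → Precision), Monotone τ ∧
    ∀ q : Precision, ∃ k : Fin (N + 2), D.act (Pref.independent, q) s = r k ∧
      (∀ j : Fin (N + 1), j.castSucc < k → τ j ≤ q) ∧
      (∀ j : Fin (N + 1), k ≤ j.castSucc → q ≤ τ j)

end LiquidDemocracy

end

/-! This is a potential game with a lexicographic second objective. If a voter changes only what her
independent types do, her utility changes exactly as the probability that the outcome matches the
state does (`expectedUtility_sub_eq_of_sincere`). Against any profile some best reply is a threshold
strategy: partisans vote for their alternative (`winGiven_le_vote`), and each action's value to an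
independent type is affine in the precision, so optimal actions can be chosen in order of slope
(`exists_monotone_lex_selection`). Hence a maximiser of the potential over threshold profiles is an
equilibrium against all deviations. It exists because Helly selection gives pointwise convergent
subsequences and utilities are continuous by dominated convergence.

For undominatedness, others' behaviour enters a voter's utility linearly through a
finite-dimensional vector. So finitely many profiles `F i` suffice for every dominance to show
strictly in the utility summed over `F i` (`exists_finset_detecting_dominance`). Among maximisers of
the potential, take one maximising the sum of these utilities over all voters. The components of
positive weight in a dominating mixture would be best replies with a larger sum on average,
contradicting lexicographic optimality. -/

noncomputable section

namespace LiquidDemocracy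

open Filter Topology

/-! ### Helly selection for monotone functions with finitely many values -/

section MonotoneSequences

variable {α : Type*} [CompleteLinearOrder α]

/-- The supremum of the points at which a function into `Fin m` has value at most `j`. -/
def cutPoint {m : ℕ} (f : α → Fin m) (j : Fin m) : α :=
  sSup {q | f q ≤ j}

theorem le_cutPoint {m : ℕ} {f : α → Fin m} {j : Fin m} {q : α} (h : f q ≤ j) :
    q ≤ cutPoint f j :=
  le_sSup h

theorem cutPoint_le {m : ℕ} {f : α →o Fin m} {j : Fin m} {q : α} (h : j < f q) :
    cutPoint f j ≤ q := by
  refine sSup_le fun q' hq' => ?_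
  by_contra hlt
  exact absurd (f.monotone (not_le.1 hlt).le) (not_le.2 (lt_of_le_of_lt hq' h))

theorem cutPoint_monotone {m : ℕ} (f : α → Fin m) : Monotone (cutPoint f) :=
  fun _ _ h => sSup_le_sSup fun _ hq => le_trans hq h

theorem le_of_lt_cutPoint {m : ℕ} {f : α →o Fin m} {j : Fin m} {q : α} (h : q < cutPoint f j) :
    f q ≤ j := by
  by_contra hlt
  exact absurd (cutPoint_le (not_le.1 hlt)) (not_le.2 h)

theorem lt_of_cutPoint_lt {m : ℕ} {f : α →o Fin m} {j : Fin m} {q : α} (h : cutPoint f j < q) :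
    j < f q := by
  by_contra hlt
  exact absurd (le_cutPoint (not_lt.1 hlt)) (not_le.2 h)

/-- A sequence in a finite type has a constant subsequence. -/
theorem exists_constant_subsequence {β : Type*} [Finite β] (u : ℕ → β) :
    ∃ (b : β) (φ : ℕ → ℕ), StrictMono φ ∧ ∀ n, u (φ n) = b := by
  obtain ⟨b, hb⟩ := Finite.exists_infinite_fiber u
  have hfreq : ∃ᶠ n in atTop, u n = b :=
    Nat.frequently_atTop_iff_infinite.2 (Set.infinite_coe_iff.1 hb)
  obtain ⟨φ, hφ, h⟩ := extraction_of_frequently_atTop hfreq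
  exact ⟨b, φ, hφ, h⟩

/-- Helly's selection theorem for finite families of monotone functions with finitely many
values. -/
theorem exists_pointwise_eventually_constant_subsequence [TopologicalSpace α] [OrderTopology α]
    [FirstCountableTopology α] {ι : Type*} [Finite ι] {m : ℕ} (f : ℕ → ι → α →o Fin m) :
    ∃ (g : ι → α →o Fin m) (φ : ℕ → ℕ), StrictMono φ ∧
      ∀ i q, ∀ᶠ n in atTop, f (φ n) i q = g i q := by
  obtain ⟨τ, -, φ, hφ, hτ⟩ := (isSeqCompact_univ (X := ι → Fin m → α)).subseq_of_frequently_in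
    (x := fun n i j => cutPoint (f n i) j) (Frequently.of_forall fun _ => Set.mem_univ _)
  have hτ' : ∀ i j, Tendsto (fun n => cutPoint (f (φ n) i) j) atTop (𝓝 (τ i j)) := fun i j =>
    tendsto_pi_nhds.1 (tendsto_pi_nhds.1 hτ i) j
  -- Convergence of the cut points says nothing at the limit cut points themselves. There are
  -- finitely many, so a further subsequence freezes all values there.
  obtain ⟨b, ψ, hψ, hb⟩ := exists_constant_subsequence
    (fun n => fun (x : ι × ι × Fin m) => f (φ n) x.1 (τ x.2.1 x.2.2))
  have key : ∀ i q, ∃ y, ∀ᶠ n in atTop, f (φ (ψ n)) i q = y := by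
    intro i q
    by_cases hq : ∃ j, τ i j = q
    · obtain ⟨j, rfl⟩ := hq
      exact ⟨b (i, i, j), Eventually.of_forall fun n => congrFun (hb n) (i, i, j)⟩
    · push Not at hq
      -- Away from the limit cut points each comparison with `j` is eventually settled, and these
      -- comparisons determine the value.
      have hj : ∀ j, ∀ᶠ n in atTop, (f (φ (ψ n)) i q ≤ j ↔ q < τ i j) := by
        intro j
        have ht := (hτ' i j).comp hψ.tendsto_atTop
        rcases lt_or_gt_of_ne (hq j) with h | h
        · filter_upwards [ht.eventually (gt_mem_nhds h)] with n hn
          exact iff_of_false (not_le.2 (lt_of_cutPoint_lt hn)) (not_lt.2 h.le)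
        · filter_upwards [ht.eventually (lt_mem_nhds h)] with n hn
          exact iff_of_true (le_of_lt_cutPoint hn) h
      obtain ⟨n₀, hn₀⟩ := eventually_atTop.1 (eventually_all.2 hj)
      refine ⟨f (φ (ψ n₀)) i q, eventually_atTop.2 ⟨n₀, fun n hn => ?_⟩⟩
      exact le_antisymm (((hn₀ n hn) _).2 (((hn₀ n₀ le_rfl) _).1 le_rfl))
        (((hn₀ n₀ le_rfl) _).2 (((hn₀ n hn) _).1 le_rfl))
  choose g hg using key
  refine ⟨fun i => ⟨g i, fun q q' hqq' => ?_⟩, φ ∘ ψ, hφ.comp hψ, hg⟩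
  obtain ⟨n, h1, h2⟩ := ((hg i q).and (hg i q')).exists
  rw [← h1, ← h2]
  exact (f (φ (ψ n)) i).monotone hqq'

end MonotoneSequences

/-! ### Monotone selection from affine families -/

/-- For two families of affine functions of a real variable, indexed by a type with `n` elements,
lexicographic maximisation is solved by a selection that is monotone in the variable for a suitable
ordering of the index type. -/
theorem exists_monotone_lex_selection {Y : Type*} [Fintype Y] [Nonempty Y] {n : ℕ}
    (hn : Fintype.card Y = n) {s : Set ℝ} (a b c d : Y → ℝ) :
    ∃ (r : Fin n ≃ Y) (g : s →o Fin n), ∀ (q : s) (y : Y),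
      a y + b y * q ≤ a (r (g q)) + b (r (g q)) * q ∧
      (a y + b y * q = a (r (g q)) + b (r (g q)) * q →
        c y + d y * q ≤ c (r (g q)) + d (r (g q)) * q) := by
  classical
  -- Primary slope, then secondary slope; the enumeration only breaks remaining ties, so that the
  -- order is linear.
  let key : Y → ℝ ×ₗ ℝ ×ₗ Fin n := fun y =>
    toLex (b y, toLex (d y, Fintype.equivFinOfCardEq hn y))
  have hkey : Function.Injective key := by
    intro y y' h
    simp only [key, Prod.mk.injEq, EmbeddingLike.apply_eq_iff_eq] at h
    exact h.2.2
  let _ : LinearOrder Y := LinearOrder.lift' key hkey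
  have key_le : ∀ y y' : Y, y ≤ y' ↔ b y < b y' ∨ b y = b y' ∧ (d y < d y' ∨ d y = d y' ∧
      Fintype.equivFinOfCardEq hn y ≤ Fintype.equivFinOfCardEq hn y') := by
    intro y y'
    change key y ≤ key y' ↔ _
    simp [key, Prod.Lex.toLex_le_toLex]
  let val : ℝ → Y → ℝ ×ₗ ℝ := fun q y => toLex (a y + b y * q, c y + d y * q)
  have val_le : ∀ q y y', val q y ≤ val q y' ↔ a y + b y * q < a y' + b y' * q ∨
      a y + b y * q = a y' + b y' * q ∧ c y + d y * q ≤ c y' + d y' * q := by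
    intro q y y'
    simp [val, Prod.Lex.toLex_le_toLex]
  let opt : ℝ → Finset Y := fun q => Finset.univ.filter fun y => ∀ y', val q y' ≤ val q y
  have hopt : ∀ q, (opt q).Nonempty := by
    intro q
    obtain ⟨y, hy⟩ := Finite.exists_max (val q)
    exact ⟨y, by simpa [opt] using hy⟩
  let sel : ℝ → Y := fun q => (opt q).max' (hopt q)
  have sel_opt : ∀ q y, val q y ≤ val q (sel q) := by
    intro q
    simpa [opt] using (opt q).max'_mem (hopt q)
  have sel_max : ∀ q y, (∀ y', val q y' ≤ val q y) → y ≤ sel q := by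
    intro q y hy
    exact (opt q).le_max' y (by simpa [opt] using hy)
  have sel_mono : Monotone sel := by
    intro q q' hqq'
    rcases hqq'.eq_or_lt with rfl | hlt
    · exact le_rfl
    have h1 := (val_le _ _ _).1 (sel_opt q (sel q'))
    have h2 := (val_le _ _ _).1 (sel_opt q' (sel q))
    generalize hy : sel q = y at *
    generalize hy' : sel q' = y' at *
    -- If the choice at `q` is still optimal at `q'`, taking the largest optimum gives the order.
    -- Otherwise, adding the optimality inequalities at `q` and `q'` compares the slopes; equal
    -- primary slopes force equal intercepts and pass the argument to the secondary objective.
    by_cases hv : val q' y' ≤ val q' y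
    · rw [← hy']
      exact sel_max q' y fun z => (hy' ▸ sel_opt q' z : val q' z ≤ val q' y').trans hv
    · rw [key_le]
      have hv' := fun h => hv ((val_le _ _ _).2 h)
      have hb : b y ≤ b y' := by
        have : a y' + b y' * q ≤ a y + b y * q := by rcases h1 with h | h <;> linarith [h]
        have : a y + b y * q' ≤ a y' + b y' * q' := by rcases h2 with h | h <;> linarith [h]
        nlinarith
      rcases hb.lt_or_eq with hb | hb
      · exact Or.inl hb
      refine Or.inr ⟨hb, ?_⟩
      rw [hb] at h1 h2 hv'
      have ha : a y = a y' := by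
        rcases h1 with h1 | h1 <;> rcases h2 with h2 | h2 <;> linarith [h1, h2]
      rw [ha] at h1 h2 hv'
      have h1' : c y' + d y' * q ≤ c y + d y * q := by
        rcases h1 with h1 | h1
        · exact absurd h1 (lt_irrefl _)
        · exact h1.2
      have h2' : c y + d y * q' < c y' + d y' * q' := by
        by_contra hc
        exact hv' (Or.inr ⟨rfl, not_lt.1 hc⟩)
      left
      nlinarith
  let e : Fin n ≃o Y := Fintype.orderIsoFinOfCardEq Y hn
  obtain ⟨r, g, hrg⟩ : ∃ (r : Fin n ≃ Y) (g : s →o Fin n), ∀ q : s, r (g q) = sel q :=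
    ⟨e.toEquiv, ⟨fun q => e.symm (sel q), fun q q' h => e.symm.monotone (sel_mono h)⟩,
      fun q => e.apply_symm_apply (sel q)⟩
  refine ⟨r, g, fun q y => ?_⟩
  rw [hrg]
  rcases (val_le _ _ _).1 (sel_opt q y) with h | h
  · exact ⟨h.le, fun h' => absurd h' h.ne⟩
  · exact ⟨h.1.le, fun _ => h.2⟩

/-! ### Actions and threshold strategies -/

/-- Makes `Precision` a complete linear order, so cut points stay in the interval and an empty
supremum is `1 / 2`. -/
instance : Fact ((1 / 2 : ℝ) ≤ 1) := ⟨by norm_num⟩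

/-- The actions of a voter as a sum type. -/
def actionEquiv {N : ℕ} (i : Fin N) : Action i ≃ (Alt ⊕ Unit) ⊕ {j : Fin N // j ≠ i} where
  toFun
    | .vote v => .inl (.inl v)
    | .abstain => .inl (.inr ())
    | .delegate j hj => .inr ⟨j, hj⟩
  invFun
    | .inl (.inl v) => .vote v
    | .inl (.inr _) => .abstain
    | .inr j => .delegate j.1 j.2
  left_inv := by rintro (_ | _ | _) <;> rfl
  right_inv := by rintro ((_ | _) | _) <;> rfl

instance {N : ℕ} (i : Fin N) : Fintype (Action i) := Fintype.ofEquiv _ (actionEquiv i).symm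

instance {N : ℕ} (i : Fin N) : DecidableEq (Action i) := Classical.decEq _

instance {N : ℕ} (i : Fin N) : Nonempty (Action i) := ⟨Action.abstain⟩

theorem card_action {N : ℕ} (i : Fin N) : Fintype.card (Action i) = N + 2 := by
  have hA : Fintype.card Alt = 2 := rfl
  have hN : 0 < N := i.pos
  rw [Fintype.card_congr (actionEquiv i)]
  simp only [ne_eq, Fintype.card_sum, hA, Fintype.card_subtype_compl,
    Fintype.card_fin, Fintype.card_unique]
  omega

/-- Preferences as an option type. -/
def prefEquiv : Pref ≃ Option Alt where
  toFun
    | .partisan v => some v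
    | .independent => none
  invFun
    | some v => .partisan v
    | none => .independent
  left_inv := by rintro (_ | _) <;> rfl
  right_inv := by rintro (_ | _) <;> rfl

instance : Finite Pref := Finite.of_equiv _ prefEquiv.symm

/-- The strategy in which partisans vote for their preferred alternative and independent types
take the actions prescribed, for each signal, by an ordering of the actions and a monotone function
of the precision. -/
def thresholdStrategy {N : ℕ} {i : Fin N}
    (θ : Signal → (Fin (N + 2) ≃ Action i) × (Precision →o Fin (N + 2))) : ExAnteStrategy i where
  act t s := match t.1 with
    | .partisan v => Action.vote v
    | .independent => (θ s).1 ((θ s).2 t.2)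
  measurable_act s := by
    refine measurable_from_prod_countable_right fun p => ?_
    cases p with
    | partisan v => exact measurable_const
    | independent =>
      refine (measurable_from_top (f := (θ s).1)).comp (measurable_to_countable' fun k => ?_)
      exact (Set.OrdConnected.preimage_mono (Set.ordConnected_singleton (a := k))
        (θ s).2.monotone).measurableSet

theorem isThreshold_thresholdStrategy {N : ℕ} {i : Fin N}
    (θ : Signal → (Fin (N + 2) ≃ Action i) × (Precision →o Fin (N + 2))) :
    IsThreshold (thresholdStrategy θ) := by
  refine ⟨fun v q s => rfl, fun s => ⟨(θ s).1, fun j => cutPoint (θ s).2 j.castSucc,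
    (cutPoint_monotone _).comp Fin.strictMono_castSucc.monotone, fun q => ⟨(θ s).2 q, rfl,
      fun j hj => cutPoint_le hj, fun j hj => le_cutPoint hj⟩⟩⟩

/-! ### Voting directly is best for partisans -/

/-- A chain that meets `i` now stops there, with the same final vote; any other chain is untouched.
-/
theorem CastsFor.update_vote {N : ℕ} {c : ∀ i : Fin N, Action i} {j : Fin N} {v : Alt}
    (h : CastsFor c j v) (i : Fin N) : CastsFor (Function.update c i (Action.vote v)) j v := by
  induction h with
  | @direct k v h =>
    refine .direct ?_
    rcases eq_or_ne k i with rfl | hk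
    · simp
    · simpa [hk] using h
  | @delegated k l v hl h _ ih =>
    rcases eq_or_ne k i with rfl | hk
    · exact .direct (by simp)
    · exact .delegated hl (by simpa [hk] using h) ih

theorem CastsFor.of_update_vote {N : ℕ} {c : ∀ i : Fin N, Action i} {i j : Fin N} {v w : Alt}
    (h : CastsFor (Function.update c i (Action.vote v)) j w) (hw : w ≠ v) : CastsFor c j w := by
  induction h with
  | @direct k w h =>
    rcases eq_or_ne k i with rfl | hk
    · simp only [Function.update_self, Action.vote.injEq] at h
      exact absurd h.symm hw
    · exact .direct (by simpa [hk] using h)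
  | @delegated k l w hl h _ ih =>
    rcases eq_or_ne k i with rfl | hk
    · simp at h
    · exact .delegated hl (by simpa [hk] using h) (ih hw)

theorem Alt.other_ne (v : Alt) : v.other ≠ v := by cases v <;> simp [Alt.other]

theorem winProb_le_update_vote {N : ℕ} (c : ∀ i : Fin N, Action i) (i : Fin N) (v : Alt) :
    winProb c v ≤ winProb (Function.update c i (Action.vote v)) v := by
  have h1 : voteCount c v ≤ voteCount (Function.update c i (Action.vote v)) v :=
    Set.ncard_le_ncard fun j hj => CastsFor.update_vote hj i
  have h2 : voteCount (Function.update c i (Action.vote v)) v.other ≤ voteCount c v.other :=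
    Set.ncard_le_ncard fun j hj => CastsFor.of_update_vote hj v.other_ne
  unfold winProb
  split_ifs <;> first | omega | norm_num

/-! ### Moments and the product form of utility -/

theorem signalProb_nonneg (q : Precision) (ω : State) (s : Signal) : 0 ≤ signalProb q ω s := by
  have h1 := q.2.1
  have h2 := q.2.2
  unfold signalProb
  split_ifs <;> linarith

theorem signalProb_le_one (q : Precision) (ω : State) (s : Signal) : signalProb q ω s ≤ 1 := by
  have h1 := q.2.1
  have h2 := q.2.2
  unfold signalProb
  split_ifs <;> linarith

theorem measurable_signalProb (ω : State) (s : Signal) :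
    Measurable fun q : Precision => signalProb q ω s := by
  unfold signalProb
  split_ifs
  · exact measurable_subtype_coe
  · exact measurable_const.sub measurable_subtype_coe

theorem Environment.stateProb_nonneg {N : ℕ} (E : Environment N) (ω : State) :
    0 ≤ E.stateProb ω := by
  cases ω
  · exact E.prior_mem.1.le
  · exact sub_nonneg.2 E.prior_mem.2.le

/-- The law of the type of a voter. -/
abbrev Environment.voterLaw {N : ℕ} (E : Environment N) (i : Fin N) : Measure VoterType :=
  (E.prefLaw i : Measure Pref).prod (E.precLaw i : Measure Precision)

/-- The probability that a voter of type `t` takes action `y` in state `ω`. -/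
def actionProb {N : ℕ} {i : Fin N} (D : ExAnteStrategy i) (ω : State) (y : Action i)
    (t : VoterType) : ℝ :=
  ∑ s, signalProb t.2 ω s * if D.act t s = y then 1 else 0

/-- The expectation of the weight `h` of the preference of a voter on the event that she takes
action `y`, in state `ω`. -/
def actionMoment {N : ℕ} (E : Environment N) {i : Fin N} (D : ExAnteStrategy i) (h : Pref → ℝ)
    (ω : State) (y : Action i) : ℝ :=
  ∫ t, h t.1 * actionProb D ω y t ∂E.voterLaw i

/-- Expected utility of voter `i` when the ex-post payoffs are given by `k`. -/
def generalUtility {N : ℕ} (E : Environment N) (k : Pref → Alt → State → ℝ)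
    (S : StrategyProfile N) (i : Fin N) : ℝ :=
  ∫ t, ∑ ω : State, E.stateProb ω * ∑ s : Fin N → Signal, (∏ j, signalProb (t j).2 ω (s j)) *
    ∑ o : Alt, winProb (fun j => (S j).act (t j) (s j)) o * k (t i).1 o ω ∂E.typeLaw

theorem expectedUtility_eq_generalUtility {N : ℕ} (E : Environment N) (S : StrategyProfile N)
    (i : Fin N) : expectedUtility E S i = generalUtility E payoff S i :=
  rfl

theorem actionProb_nonneg {N : ℕ} {i : Fin N} (D : ExAnteStrategy i) (ω : State) (y : Action i)
    (t : VoterType) : 0 ≤ actionProb D ω y t := by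
  refine Finset.sum_nonneg fun s _ => mul_nonneg (signalProb_nonneg _ _ _) ?_
  split_ifs <;> norm_num

theorem actionProb_le_two {N : ℕ} {i : Fin N} (D : ExAnteStrategy i) (ω : State) (y : Action i)
    (t : VoterType) : actionProb D ω y t ≤ 2 := by
  have h : actionProb D ω y t ≤ ∑ _s : Signal, (1 : ℝ) := by
    refine Finset.sum_le_sum fun s _ => mul_le_one₀ (signalProb_le_one _ _ _) ?_ ?_ <;>
      split_ifs <;> norm_num
  refine h.trans_eq ?_
  rw [Finset.sum_const, Finset.card_univ, show Fintype.card Signal = 2 from rfl]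
  norm_num

theorem measurable_actionProb {N : ℕ} {i : Fin N} (D : ExAnteStrategy i) (ω : State)
    (y : Action i) : Measurable (actionProb D ω y) := by
  refine Finset.measurable_sum _ fun s _ =>
    ((measurable_signalProb ω s).comp measurable_snd).mul ?_
  exact (measurable_from_top (f := fun z : Action i => if z = y then (1 : ℝ) else 0)).comp
    (D.measurable_act s)

theorem measurable_prefWeight (h : Pref → ℝ) : Measurable fun t : VoterType => h t.1 :=
  measurable_from_top.comp measurable_fst

theorem exists_prefWeight_bound (h : Pref → ℝ) : ∃ C, ∀ p, |h p| ≤ C := by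
  obtain ⟨p, hp⟩ := Finite.exists_max (α := Option Alt) fun p => |h (prefEquiv.symm p)|
  exact ⟨_, fun p' => by simpa using hp (prefEquiv p')⟩

theorem norm_prefWeight_mul_actionProb_le {N : ℕ} {i : Fin N} (D : ExAnteStrategy i) {h : Pref → ℝ}
    {C : ℝ} (hC : ∀ p, |h p| ≤ C) (ω : State) (y : Action i) (t : VoterType) :
    ‖h t.1 * actionProb D ω y t‖ ≤ C * 2 := by
  rw [norm_mul, Real.norm_eq_abs, Real.norm_of_nonneg (actionProb_nonneg _ _ _ _)]
  exact mul_le_mul (hC _) (actionProb_le_two _ _ _ _) (actionProb_nonneg _ _ _ _)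
    ((abs_nonneg _).trans (hC t.1))

theorem integrable_prefWeight_mul_actionProb {N : ℕ} (E : Environment N) {i : Fin N}
    (D : ExAnteStrategy i) (h : Pref → ℝ) (ω : State) (y : Action i) :
    Integrable (fun t => h t.1 * actionProb D ω y t) (E.voterLaw i) := by
  obtain ⟨C, hC⟩ := exists_prefWeight_bound h
  exact Integrable.of_bound
    ((measurable_prefWeight h).mul (measurable_actionProb D ω y)).aestronglyMeasurable (C * 2)
    (Eventually.of_forall fun t => norm_prefWeight_mul_actionProb_le D hC ω y t)

/-- Expectations over the signals as expectations over the actions. -/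
theorem sum_signals_eq_sum_actions {N : ℕ} (S : StrategyProfile N) (t : Fin N → VoterType)
    (ω : State) (F : (∀ j : Fin N, Action j) → ℝ) :
    ∑ s : Fin N → Signal, (∏ j, signalProb (t j).2 ω (s j)) *
        F (fun j => (S j).act (t j) (s j)) =
      ∑ c : ∀ j : Fin N, Action j, F c * ∏ j, actionProb (S j) ω (c j) (t j) := by
  have h : ∀ c : ∀ j : Fin N, Action j, ∏ j, actionProb (S j) ω (c j) (t j) =
      ∑ s : Fin N → Signal, (∏ j, signalProb (t j).2 ω (s j)) *
        if (fun j => (S j).act (t j) (s j)) = c then 1 else 0 := by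
    intro c
    unfold actionProb
    rw [Finset.prod_univ_sum, Fintype.piFinset_univ]
    refine Finset.sum_congr rfl fun s _ => ?_
    rw [Finset.prod_mul_distrib, Finset.prod_ite_zero]
    simp [funext_iff]
  simp_rw [h, Finset.mul_sum]
  rw [Finset.sum_comm]
  refine Finset.sum_congr rfl fun s _ => ?_
  rw [Finset.sum_eq_single (fun j => (S j).act (t j) (s j))]
  · simp [mul_comm]
  · intro c _ hc
    simp [hc.symm]
  · simp

/-- The weights of the preferences of the voters in the utility of voter `i`. -/
def voterWeight {N : ℕ} (i : Fin N) (h : Pref → ℝ) (j : Fin N) : Pref → ℝ :=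
  if j = i then h else fun _ => 1

/-- Given the state, types and signals are independent across voters, so the integral factors.
Utility becomes a polynomial in finitely many one-voter moments, the source of both continuity and
linearity in the others' behaviour. -/
theorem generalUtility_eq_sum {N : ℕ} (E : Environment N) (k : Pref → Alt → State → ℝ)
    (S : StrategyProfile N) (i : Fin N) :
    generalUtility E k S i = ∑ ω, ∑ c : ∀ j : Fin N, Action j, ∑ o, E.stateProb ω *
      (winProb c o * ∏ j, actionMoment E (S j) (voterWeight i (fun p => k p o ω) j) ω (c j)) := by
  have hpt : ∀ t : Fin N → VoterType, ∑ ω : State, E.stateProb ω *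
      ∑ s : Fin N → Signal, (∏ j, signalProb (t j).2 ω (s j)) *
        ∑ o : Alt, winProb (fun j => (S j).act (t j) (s j)) o * k (t i).1 o ω =
      ∑ ω, ∑ c : ∀ j : Fin N, Action j, ∑ o, E.stateProb ω * (winProb c o *
        ∏ j, (voterWeight i (fun p => k p o ω) j (t j).1 * actionProb (S j) ω (c j) (t j))) := by
    intro t
    refine Finset.sum_congr rfl fun ω _ => ?_
    rw [sum_signals_eq_sum_actions S t ω (fun c => ∑ o : Alt, winProb c o * k (t i).1 o ω),
      Finset.mul_sum]
    refine Finset.sum_congr rfl fun c _ => ?_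
    rw [Finset.sum_mul, Finset.mul_sum]
    refine Finset.sum_congr rfl fun o _ => ?_
    rw [Finset.prod_mul_distrib]
    have : ∏ j, voterWeight i (fun p => k p o ω) j (t j).1 = k (t i).1 o ω := by
      rw [Finset.prod_eq_single i]
      · simp [voterWeight]
      · intro j _ hj
        simp [voterWeight, hj]
      · simp
    rw [this]
    ring
  have hint : ∀ (ω : State) (c : ∀ j : Fin N, Action j) (o : Alt),
      Integrable (fun t : Fin N → VoterType => E.stateProb ω * (winProb c o *
        ∏ j, (voterWeight i (fun p => k p o ω) j (t j).1 * actionProb (S j) ω (c j) (t j))))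
        E.typeLaw := by
    intro ω c o
    refine Integrable.const_mul (Integrable.const_mul ?_ _) _
    exact Integrable.fintype_prod_dep
      (f := fun j t => voterWeight i (fun p => k p o ω) j t.1 * actionProb (S j) ω (c j) t)
      fun j => integrable_prefWeight_mul_actionProb E (S j) _ ω (c j)
  unfold generalUtility
  simp_rw [hpt]
  rw [integral_finsetSum _ fun ω _ => integrable_finsetSum _ fun c _ =>
    integrable_finsetSum _ fun o _ => hint ω c o]
  refine Finset.sum_congr rfl fun ω _ => ?_
  rw [integral_finsetSum _ fun c _ => integrable_finsetSum _ fun o _ => hint ω c o]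
  refine Finset.sum_congr rfl fun c _ => ?_
  rw [integral_finsetSum _ fun o _ => hint ω c o]
  refine Finset.sum_congr rfl fun o _ => ?_
  rw [integral_const_mul, integral_const_mul]
  congr 2
  exact integral_fintype_prod_eq_prod
    (fun j (t : VoterType) =>
      voterWeight i (fun p => k p o ω) j t.1 * actionProb (S j) ω (c j) t)

/-! ### Continuity under pointwise convergence -/

theorem tendsto_actionMoment {N : ℕ} (E : Environment N) {i : Fin N} {D : ℕ → ExAnteStrategy i}
    {D' : ExAnteStrategy i} (hD : ∀ t s, ∀ᶠ n in atTop, (D n).act t s = D'.act t s)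
    (h : Pref → ℝ) (ω : State) (y : Action i) :
    Tendsto (fun n => actionMoment E (D n) h ω y) atTop (𝓝 (actionMoment E D' h ω y)) := by
  obtain ⟨C, hC⟩ := exists_prefWeight_bound h
  refine MeasureTheory.tendsto_integral_of_dominated_convergence (fun _ => C * 2)
    (fun n => (integrable_prefWeight_mul_actionProb E (D n) h ω y).aestronglyMeasurable)
    (integrable_const _)
    (fun n => Eventually.of_forall fun t => norm_prefWeight_mul_actionProb_le (D n) hC ω y t)
    (Eventually.of_forall fun t => tendsto_const_nhds.congr' ?_)
  filter_upwards [eventually_all.2 (hD t)] with n hn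
  simp only [actionProb, hn]

theorem tendsto_generalUtility {N : ℕ} (E : Environment N) (k : Pref → Alt → State → ℝ)
    {S : ℕ → StrategyProfile N} {S' : StrategyProfile N}
    (hS : ∀ j t s, ∀ᶠ n in atTop, (S n j).act t s = (S' j).act t s) (i : Fin N) :
    Tendsto (fun n => generalUtility E k (S n) i) atTop (𝓝 (generalUtility E k S' i)) := by
  simp_rw [generalUtility_eq_sum]
  refine tendsto_finsetSum _ fun ω _ => tendsto_finsetSum _ fun c _ =>
    tendsto_finsetSum _ fun o _ => Tendsto.const_mul _ (Tendsto.const_mul _ ?_)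
  exact tendsto_finsetProd _ fun j _ => tendsto_actionMoment E (hS j) _ ω (c j)

/-! ### The decision problem of a single voter -/

/-- The probability that the voters other than `i` take the actions `c` in state `ω`. -/
def othersProb {N : ℕ} (E : Environment N) (S : StrategyProfile N) (i : Fin N) (ω : State)
    (c : ∀ j : Fin N, Action j) : ℝ :=
  ∏ j ∈ Finset.univ.erase i, actionMoment E (S j) (fun _ => 1) ω (c j)

theorem othersProb_nonneg {N : ℕ} (E : Environment N) (S : StrategyProfile N) (i : Fin N)
    (ω : State) (c : ∀ j : Fin N, Action j) : 0 ≤ othersProb E S i ω c :=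
  Finset.prod_nonneg fun _ _ => integral_nonneg fun t => by
    simpa using actionProb_nonneg _ _ _ t

theorem othersProb_update {N : ℕ} (E : Environment N) (S : StrategyProfile N) (i : Fin N)
    (ω : State) (c : ∀ j : Fin N, Action j) (y : Action i) :
    othersProb E S i ω (Function.update c i y) = othersProb E S i ω c := by
  refine Finset.prod_congr rfl fun j hj => ?_
  rw [Function.update_of_ne (Finset.ne_of_mem_erase hj)]

theorem generalUtility_update {N : ℕ} (E : Environment N) (k : Pref → Alt → State → ℝ)
    (S : StrategyProfile N) (i : Fin N) (D : ExAnteStrategy i) :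
    generalUtility E k (Function.update S i D) i =
      ∑ ω, ∑ c : ∀ j : Fin N, Action j, ∑ o, E.stateProb ω * (winProb c o *
        (actionMoment E D (fun p => k p o ω) ω (c i) * othersProb E S i ω c)) := by
  rw [generalUtility_eq_sum]
  refine Finset.sum_congr rfl fun ω _ => Finset.sum_congr rfl fun c _ =>
    Finset.sum_congr rfl fun o _ => ?_
  rw [← Finset.mul_prod_erase _ _ (Finset.mem_univ i), Function.update_self, othersProb]
  congr 3
  · simp [voterWeight]
  · refine Finset.prod_congr rfl fun j hj => ?_
    have hj' := Finset.ne_of_mem_erase hj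
    simp [voterWeight, hj']

/-- The probability that `o` wins in state `ω` if voter `i` takes action `y`. -/
def winGiven {N : ℕ} (E : Environment N) (S : StrategyProfile N) (i : Fin N) (ω : State)
    (y : Action i) (o : Alt) : ℝ :=
  ∑ c : ∀ j : Fin N, Action j with c i = y, winProb c o * othersProb E S i ω c

/-- The others' weights do not depend on the action of `i`, so replacing `y` by the vote in each
profile allows a termwise comparison. -/
theorem winGiven_le_vote {N : ℕ} (E : Environment N) (S : StrategyProfile N) (i : Fin N)
    (ω : State) (y : Action i) (v : Alt) :
    winGiven E S i ω y v ≤ winGiven E S i ω (Action.vote v) v := by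
  have h : winGiven E S i ω (Action.vote v) v = ∑ c : ∀ j : Fin N, Action j with c i = y,
      winProb (Function.update c i (Action.vote v)) v * othersProb E S i ω c := by
    refine Finset.sum_nbij' (fun c => Function.update c i y)
      (fun c => Function.update c i (Action.vote v)) ?_ ?_ ?_ ?_ ?_
    · simp
    · simp
    · intro c hc
      simp [← (Finset.mem_filter.1 hc).2]
    · intro c hc
      simp [← (Finset.mem_filter.1 hc).2]
    · intro c hc
      rw [othersProb_update]
      simp [← (Finset.mem_filter.1 hc).2]
  rw [h]
  exact Finset.sum_le_sum fun c _ =>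
    mul_le_mul_of_nonneg_right (winProb_le_update_vote c i v) (othersProb_nonneg _ _ _ _ _)

/-- The contribution to the utility of voter `i` of action `y` after signal `s`, for a type with
preference `p` and precision `q`. -/
def actionValue {N : ℕ} (E : Environment N) (k : Pref → Alt → State → ℝ) (S : StrategyProfile N)
    (i : Fin N) (p : Pref) (q : Precision) (s : Signal) (y : Action i) : ℝ :=
  ∑ ω, E.stateProb ω * signalProb q ω s * ∑ o, k p o ω * winGiven E S i ω y o

theorem sum_stateSum_eq_sum_actionValue {N : ℕ} (E : Environment N) (k : Pref → Alt → State → ℝ)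
    (S : StrategyProfile N) (i : Fin N) (D : ExAnteStrategy i) (t : VoterType) :
    ∑ ω, ∑ c : ∀ j : Fin N, Action j, ∑ o, E.stateProb ω * (winProb c o *
        (k t.1 o ω * actionProb D ω (c i) t * othersProb E S i ω c)) =
      ∑ s, actionValue E k S i t.1 t.2 s (D.act t s) := by
  unfold actionValue
  refine (Finset.sum_congr rfl fun ω _ => ?_).trans Finset.sum_comm
  unfold actionProb winGiven
  simp_rw [Finset.sum_filter, Finset.mul_sum, Finset.sum_mul, Finset.mul_sum]
  refine Finset.sum_comm.trans ((Finset.sum_congr rfl fun o _ => ?_).trans Finset.sum_comm)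
  refine Finset.sum_comm.trans (Finset.sum_congr rfl fun s _ => Finset.sum_congr rfl fun c _ => ?_)
  simp only [eq_comm (a := c i)]
  split_ifs <;> ring

/-- With the others integrated out, optimisation separates over types and signals. -/
theorem generalUtility_update_eq_integral {N : ℕ} (E : Environment N)
    (k : Pref → Alt → State → ℝ) (S : StrategyProfile N) (i : Fin N) (D : ExAnteStrategy i) :
    Integrable (fun t => ∑ s, actionValue E k S i t.1 t.2 s (D.act t s)) (E.voterLaw i) ∧
    generalUtility E k (Function.update S i D) i =
      ∫ t, ∑ s, actionValue E k S i t.1 t.2 s (D.act t s) ∂E.voterLaw i := by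
  simp_rw [← sum_stateSum_eq_sum_actionValue]
  have hint : ∀ (ω : State) (c : ∀ j : Fin N, Action j) (o : Alt),
      Integrable (fun t : VoterType => E.stateProb ω * (winProb c o *
        (k t.1 o ω * actionProb D ω (c i) t * othersProb E S i ω c))) (E.voterLaw i) :=
    fun ω c o => Integrable.const_mul (Integrable.const_mul (Integrable.mul_const
      (integrable_prefWeight_mul_actionProb E D (fun p => k p o ω) ω (c i)) _) _) _
  refine ⟨integrable_finsetSum _ fun ω _ => integrable_finsetSum _ fun c _ =>
    integrable_finsetSum _ fun o _ => hint ω c o, ?_⟩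
  rw [generalUtility_update, integral_finsetSum _ fun ω _ => integrable_finsetSum _ fun c _ =>
    integrable_finsetSum _ fun o _ => hint ω c o]
  refine Finset.sum_congr rfl fun ω _ => ?_
  rw [integral_finsetSum _ fun c _ => integrable_finsetSum _ fun o _ => hint ω c o]
  refine Finset.sum_congr rfl fun c _ => ?_
  rw [integral_finsetSum _ fun o _ => hint ω c o]
  refine Finset.sum_congr rfl fun o _ => ?_
  rw [integral_const_mul, integral_const_mul, integral_mul_const]
  rfl

/-! ### Finite detection of weak dominance -/

/-- Finitely many values of a function into a finite-dimensional space determine which linear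
functionals vanish on its range. -/
theorem exists_finset_forall_linearMap_eq_zero {X V : Type*} [AddCommGroup V] [Module ℝ V]
    [FiniteDimensional ℝ V] (f : X → V) :
    ∃ F : Finset X, ∀ L : V →ₗ[ℝ] ℝ, (∀ x ∈ F, L (f x) = 0) → ∀ x, L (f x) = 0 := by
  classical
  obtain ⟨s, hs, hspan⟩ := (Submodule.fg_span_iff_fg_span_finset_subset (R := ℝ) (Set.range f)).1
    (IsNoetherian.noetherian _)
  obtain ⟨F, rfl⟩ : ∃ F : Finset X, F.image f = s := by
    obtain ⟨F, -, hF⟩ := (Finset.subset_set_image_iff (s := Set.univ) (f := f)).1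
      (by rwa [Set.image_univ] : (s : Set V) ⊆ f '' Set.univ)
    exact ⟨F, hF⟩
  refine ⟨F, fun L hL x => ?_⟩
  have hx : f x ∈ Submodule.span ℝ ((F.image f : Finset V) : Set V) :=
    hspan ▸ Submodule.subset_span (Set.mem_range_self x)
  have hle : Submodule.span ℝ ((F.image f : Finset V) : Set V) ≤ LinearMap.ker L := by
    rw [Submodule.span_le]
    intro y hy
    obtain ⟨z, hz, rfl⟩ := Finset.mem_image.1 (Finset.mem_coe.1 hy)
    exact hL z hz
  exact hle hx

theorem exists_linearMap_expectedUtility {N : ℕ} (E : Environment N) (i : Fin N)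
    (D : ExAnteStrategy i) :
    ∃ L : (State × (∀ j : Fin N, Action j) → ℝ) →ₗ[ℝ] ℝ, ∀ S : StrategyProfile N,
      expectedUtility E (Function.update S i D) i = L fun x => othersProb E S i x.1 x.2 := by
  refine ⟨∑ ω, ∑ c : ∀ j : Fin N, Action j, ∑ o, (E.stateProb ω * (winProb c o *
    actionMoment E D (fun p => payoff p o ω) ω (c i))) • LinearMap.proj (ω, c), fun S => ?_⟩
  rw [expectedUtility_eq_generalUtility, generalUtility_update]
  simp only [LinearMap.sum_apply, LinearMap.smul_apply, LinearMap.proj_apply, smul_eq_mul,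
    mul_assoc]

/-- There are finitely many profiles of the others against which every weak dominance shows. -/
theorem exists_finset_detecting_dominance {N : ℕ} (E : Environment N) (i : Fin N) :
    ∃ F : Finset (StrategyProfile N), ∀ (D : ExAnteStrategy i) (m : ℕ) (w : Fin m → ℝ)
      (D' : Fin m → ExAnteStrategy i),
      (∀ S : StrategyProfile N, expectedUtility E (Function.update S i D) i ≤
        ∑ k, w k * expectedUtility E (Function.update S i (D' k)) i) →
      (∃ S : StrategyProfile N, expectedUtility E (Function.update S i D) i <
        ∑ k, w k * expectedUtility E (Function.update S i (D' k)) i) →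
      ∑ S ∈ F, expectedUtility E (Function.update S i D) i <
        ∑ k, w k * ∑ S ∈ F, expectedUtility E (Function.update S i (D' k)) i := by
  obtain ⟨F, hF⟩ := exists_finset_forall_linearMap_eq_zero
    fun (S : StrategyProfile N) (x : State × (∀ j : Fin N, Action j)) =>
      othersProb E S i x.1 x.2
  refine ⟨F, fun D m w D' hle hlt => ?_⟩
  choose L hL using exists_linearMap_expectedUtility E i
  have hdiff : ∀ S : StrategyProfile N,
      (∑ k, w k • L (D' k) - L D) (fun x => othersProb E S i x.1 x.2) =
        ∑ k, w k * expectedUtility E (Function.update S i (D' k)) i -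
          expectedUtility E (Function.update S i D) i := by
    intro S
    simp only [hL, LinearMap.sub_apply, LinearMap.sum_apply, LinearMap.smul_apply, smul_eq_mul]
  simp_rw [Finset.mul_sum]
  rw [Finset.sum_comm]
  refine Finset.sum_lt_sum (fun S _ => hle S) ?_
  -- With no strict inequality on `F`, the difference functional vanishes on `F`, hence on every
  -- profile, contradicting strictness somewhere.
  by_contra! hge
  obtain ⟨S, hS⟩ := hlt
  have h0 := hF (∑ k, w k • L (D' k) - L D)
    (fun S hS => by rw [hdiff, le_antisymm (hge S hS) (hle S), sub_self]) S
  rw [hdiff] at h0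
  linarith

/-! ### Lexicographic best replies in threshold form -/

theorem exists_affine_actionValue {N : ℕ} (E : Environment N) (k : Pref → Alt → State → ℝ)
    (S : StrategyProfile N) (i : Fin N) (p : Pref) (s : Signal) :
    ∃ a b : Action i → ℝ, ∀ (q : Precision) y, actionValue E k S i p q s y = a y + b y * q := by
  refine ⟨fun y => ∑ ω, E.stateProb ω * (if s = ω then 0 else 1) *
    ∑ o, k p o ω * winGiven E S i ω y o, fun y => ∑ ω, E.stateProb ω * (if s = ω then 1 else -1) *
    ∑ o, k p o ω * winGiven E S i ω y o, fun q y => ?_⟩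
  unfold actionValue signalProb
  rw [Finset.sum_mul, ← Finset.sum_add_distrib]
  refine Finset.sum_congr rfl fun ω _ => ?_
  split_ifs <;> ring

theorem actionValue_partisan_le_vote {N : ℕ} (E : Environment N) (S : StrategyProfile N)
    (i : Fin N) (v : Alt) (q : Precision) (s : Signal) (y : Action i) :
    actionValue E payoff S i (.partisan v) q s y ≤
      actionValue E payoff S i (.partisan v) q s (Action.vote v) := by
  refine Finset.sum_le_sum fun ω _ => mul_le_mul_of_nonneg_left ?_
    (mul_nonneg (E.stateProb_nonneg ω) (signalProb_nonneg q ω s))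
  simpa [payoff] using winGiven_le_vote E S i ω y v

/-- A threshold strategy that is pointwise optimal against `S` and, among the optimal actions,
against the sum of the profiles in `F`. -/
theorem exists_threshold_lex_reply {N : ℕ} (E : Environment N) (S : StrategyProfile N)
    (F : Finset (StrategyProfile N)) (i : Fin N) :
    ∃ θ : Signal → (Fin (N + 2) ≃ Action i) × (Precision →o Fin (N + 2)),
      ∀ (t : VoterType) (s : Signal) (y : Action i),
        actionValue E payoff S i t.1 t.2 s y ≤
          actionValue E payoff S i t.1 t.2 s ((thresholdStrategy θ).act t s) ∧
        (actionValue E payoff S i t.1 t.2 s y =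
          actionValue E payoff S i t.1 t.2 s ((thresholdStrategy θ).act t s) →
          ∑ T ∈ F, actionValue E payoff T i t.1 t.2 s y ≤
            ∑ T ∈ F, actionValue E payoff T i t.1 t.2 s ((thresholdStrategy θ).act t s)) := by
  choose a b hab using fun (T : StrategyProfile N) (s : Signal) =>
    exists_affine_actionValue E payoff T i .independent s
  choose r g hrg using fun s : Signal =>
    exists_monotone_lex_selection (s := Set.Icc (1 / 2 : ℝ) 1) (card_action i) (a S s) (b S s)
      (fun y => ∑ T ∈ F, a T s y) (fun y => ∑ T ∈ F, b T s y)
  refine ⟨fun s => (r s, g s), ?_⟩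
  rintro ⟨p | _, q⟩ s y
  · exact ⟨actionValue_partisan_le_vote E S i p q s y, fun _ =>
      Finset.sum_le_sum fun T _ => actionValue_partisan_le_vote E T i p q s y⟩
  · simp only [hab, Finset.sum_add_distrib, ← Finset.sum_mul]
    exact hrg s q y

/-- A pointwise lexicographically optimal strategy is lexicographically optimal in expectation. -/
theorem expectedUtility_le_of_lex_reply {N : ℕ} (E : Environment N) (S : StrategyProfile N)
    (F : Finset (StrategyProfile N)) (i : Fin N) (D' : ExAnteStrategy i)
    (hD' : ∀ (t : VoterType) (s : Signal) (y : Action i),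
      actionValue E payoff S i t.1 t.2 s y ≤ actionValue E payoff S i t.1 t.2 s (D'.act t s) ∧
      (actionValue E payoff S i t.1 t.2 s y = actionValue E payoff S i t.1 t.2 s (D'.act t s) →
        ∑ T ∈ F, actionValue E payoff T i t.1 t.2 s y ≤
          ∑ T ∈ F, actionValue E payoff T i t.1 t.2 s (D'.act t s))) (D : ExAnteStrategy i) :
    expectedUtility E (Function.update S i D) i ≤ expectedUtility E (Function.update S i D') i ∧
    (expectedUtility E (Function.update S i D) i = expectedUtility E (Function.update S i D') i →
      ∑ T ∈ F, expectedUtility E (Function.update T i D) i ≤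
        ∑ T ∈ F, expectedUtility E (Function.update T i D') i) := by
  have hI := fun T => generalUtility_update_eq_integral E payoff T i D
  have hI' := fun T => generalUtility_update_eq_integral E payoff T i D'
  simp only [expectedUtility_eq_generalUtility, (hI _).2, (hI' _).2]
  have hle : ∀ t : VoterType, ∑ s, actionValue E payoff S i t.1 t.2 s (D.act t s) ≤
      ∑ s, actionValue E payoff S i t.1 t.2 s (D'.act t s) :=
    fun t => Finset.sum_le_sum fun s _ => (hD' t s _).1
  refine ⟨integral_mono (hI S).1 (hI' S).1 hle, fun heq => ?_⟩
  -- Equal expectations force pointwise optimality almost everywhere, which makes the secondary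
  -- comparison available there.
  have hae := (integral_eq_iff_of_ae_le (hI S).1 (hI' S).1 (Eventually.of_forall hle)).1 heq
  rw [← integral_finsetSum _ fun T _ => (hI T).1, ← integral_finsetSum _ fun T _ => (hI' T).1]
  refine integral_mono_ae (integrable_finsetSum _ fun T _ => (hI T).1)
    (integrable_finsetSum _ fun T _ => (hI' T).1) ?_
  filter_upwards [hae] with t ht
  rw [Finset.sum_comm, Finset.sum_comm (s := F)]
  refine Finset.sum_le_sum fun s _ => (hD' t s _).2 ?_
  exact (Finset.sum_eq_sum_iff_of_le fun s _ => (hD' t s _).1).1 ht s (Finset.mem_univ s)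

/-! ### The potential and its lexicographic maximisers -/

/-- The probability that the outcome matches the state is a potential for the strategies in which
partisans vote for their preferred alternative. -/
theorem expectedUtility_sub_eq_of_sincere {N : ℕ} (E : Environment N) (S : StrategyProfile N)
    (i : Fin N) (D D' : ExAnteStrategy i)
    (h : ∀ v q s, D.act (.partisan v, q) s = D'.act (.partisan v, q) s) :
    expectedUtility E (Function.update S i D) i - expectedUtility E (Function.update S i D') i =
      generalUtility E (fun _ => payoff .independent) (Function.update S i D) i -
        generalUtility E (fun _ => payoff .independent) (Function.update S i D') i := by
  have hI := fun k => generalUtility_update_eq_integral E k S i D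
  have hI' := fun k => generalUtility_update_eq_integral E k S i D'
  simp only [expectedUtility_eq_generalUtility, (hI _).2, (hI' _).2]
  rw [← integral_sub (hI _).1 (hI' _).1, ← integral_sub (hI _).1 (hI' _).1]
  refine integral_congr_ae (Eventually.of_forall ?_)
  rintro ⟨p | _, q⟩
  · simp only [h, sub_self]
  · rfl

/-- A profile of threshold strategies is specified by, for every voter and signal, an ordering of
her actions and a monotone function of the precision. -/
abbrev ThresholdParameters (N : ℕ) : Type :=
  ∀ i : Fin N, Signal → (Fin (N + 2) ≃ Action i) × (Precision →o Fin (N + 2))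

/-- The profile of threshold strategies with given parameters. -/
def thresholdProfile {N : ℕ} (θ : ThresholdParameters N) : StrategyProfile N :=
  fun i => thresholdStrategy (θ i)

theorem exists_convergent_subsequence_thresholdProfile {N : ℕ} (θ : ℕ → ThresholdParameters N) :
    ∃ (θ' : ThresholdParameters N) (φ : ℕ → ℕ), StrictMono φ ∧ ∀ i t s, ∀ᶠ n in atTop,
      (thresholdProfile (θ (φ n)) i).act t s = (thresholdProfile θ' i).act t s := by
  obtain ⟨r, φ, hφ, hr⟩ := exists_constant_subsequence fun n i s => (θ n i s).1
  obtain ⟨g, ψ, hψ, hg⟩ := exists_pointwise_eventually_constant_subsequence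
    fun n (x : Fin N × Signal) => (θ (φ n) x.1 x.2).2
  refine ⟨fun i s => (r i s, g (i, s)), φ ∘ ψ, hφ.comp hψ, ?_⟩
  rintro i ⟨p | _, q⟩ s
  · exact Eventually.of_forall fun n => rfl
  · filter_upwards [hg (i, s) q] with n hn
    have hrn := congrFun (congrFun (hr (ψ n)) i) s
    simp only [thresholdProfile, thresholdStrategy, Function.comp_apply]
    rw [hn, hrn]

/-- A pair of real functions with compact range has a lexicographic maximum. -/
theorem exists_lex_max {X : Type*} [Nonempty X] {f g : X → ℝ}
    (h : IsCompact (Set.range fun x => (f x, g x))) :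
    ∃ x, (∀ y, f y ≤ f x) ∧ ∀ y, f y = f x → g y ≤ g x := by
  obtain ⟨_, ⟨x, rfl⟩, hx⟩ := h.exists_isMaxOn (Set.range_nonempty _) continuous_fst.continuousOn
  have hclosed : IsClosed {z : ℝ × ℝ | z.1 = f x} := isClosed_eq continuous_fst continuous_const
  obtain ⟨_, ⟨⟨y, rfl⟩, hy⟩, hmax⟩ := (h.inter_right hclosed).exists_isMaxOn
    ⟨(f x, g x), ⟨x, rfl⟩, rfl⟩ continuous_snd.continuousOn
  have hy' : f y = f x := hy
  refine ⟨y, fun z => ?_, fun z hz => ?_⟩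
  · rw [hy']
    exact hx (Set.mem_range_self z)
  · exact hmax ⟨⟨z, rfl⟩, hz.trans hy'⟩

/-- The second objective tests each voter only against the fixed profiles in `F i`, so a unilateral
change affects only her own summand. -/
theorem exists_lex_max_thresholdProfile {N : ℕ} (E : Environment N) (i₀ : Fin N)
    (F : Fin N → Finset (StrategyProfile N)) :
    ∃ θ : ThresholdParameters N,
      (∀ θ', generalUtility E (fun _ => payoff .independent) (thresholdProfile θ') i₀ ≤
        generalUtility E (fun _ => payoff .independent) (thresholdProfile θ) i₀) ∧
      ∀ θ', generalUtility E (fun _ => payoff .independent) (thresholdProfile θ') i₀ =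
          generalUtility E (fun _ => payoff .independent) (thresholdProfile θ) i₀ →
        ∑ i, ∑ T ∈ F i, expectedUtility E (Function.update T i (thresholdProfile θ' i)) i ≤
          ∑ i, ∑ T ∈ F i, expectedUtility E (Function.update T i (thresholdProfile θ i)) i := by
  have : Nonempty (ThresholdParameters N) :=
    ⟨fun i _ => ((Fintype.equivFinOfCardEq (card_action i)).symm, ⟨fun _ => 0, monotone_const⟩)⟩
  refine exists_lex_max (IsSeqCompact.isCompact fun x hx => ?_)
  choose θ hθ using hx
  obtain ⟨θ', φ, hφ, hlim⟩ := exists_convergent_subsequence_thresholdProfile θ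
  refine ⟨_, ⟨θ', rfl⟩, φ, hφ, ?_⟩
  have hx : x = fun n => _ := funext fun n => (hθ n).symm
  rw [hx]
  refine Tendsto.prodMk_nhds (tendsto_generalUtility E _ hlim i₀) ?_
  refine tendsto_finsetSum _ fun i _ => tendsto_finsetSum _ fun T _ =>
    tendsto_generalUtility E payoff (fun j t s => ?_) i
  rcases eq_or_ne j i with rfl | hj
  · simpa using hlim j t s
  · simp [hj]

end LiquidDemocracy

/-! ### Equilibrium and undominatedness -/

open LiquidDemocracy in
/-- Existence of a pure, undominated Bayes-Nash equilibrium in threshold strategies under liquid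
democracy with privately known types. -/
theorem mainTheorem2 (N : ℕ) (E : LiquidDemocracy.Environment N) :
    ∃ S : LiquidDemocracy.StrategyProfile N,
      LiquidDemocracy.IsUndominatedEquilibrium E S ∧ ∀ i, LiquidDemocracy.IsThreshold (S i) := by
  rcases isEmpty_or_nonempty (Fin N) with hN | ⟨⟨i₀⟩⟩
  · exact ⟨fun i => isEmptyElim i, ⟨fun i => isEmptyElim i, fun i => isEmptyElim i⟩,
      fun i => isEmptyElim i⟩
  choose F hF using exists_finset_detecting_dominance E
  obtain ⟨θ, hmax₁, hmax₂⟩ := exists_lex_max_thresholdProfile E i₀ F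
  set S := thresholdProfile θ with hS
  have hself : ∀ i, Function.update S i (S i) = S := fun i => Function.update_eq_self i S
  choose ρ hρ using fun i => exists_threshold_lex_reply E S (F i) i
  have hupd : ∀ i, Function.update S i (thresholdStrategy (ρ i)) =
      thresholdProfile (Function.update θ i (ρ i)) := by
    intro i
    funext j
    rcases eq_or_ne j i with rfl | hj
    · simp [thresholdProfile]
    · simp [thresholdProfile, hj, hS]
  have hbest := fun i => expectedUtility_le_of_lex_reply E S (F i) i _ (hρ i)
  have hpot : ∀ i, expectedUtility E (Function.update S i (thresholdStrategy (ρ i))) i -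
      expectedUtility E S i =
      generalUtility E (fun _ => payoff .independent)
        (thresholdProfile (Function.update θ i (ρ i))) i₀ -
      generalUtility E (fun _ => payoff .independent) S i₀ := by
    intro i
    have h := expectedUtility_sub_eq_of_sincere E S i (thresholdStrategy (ρ i)) (S i)
      fun _ _ _ => rfl
    rw [hself, hupd] at h
    rw [hupd]
    -- The common payoff ignores preferences, so its values at `i` and `i₀` agree definitionally.
    exact h
  have hreply : ∀ i, expectedUtility E (Function.update S i (thresholdStrategy (ρ i))) i =
      expectedUtility E S i := by
    intro i
    -- The reply cannot raise the maximal potential, yet it is a best reply; so `S i` is one too.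
    refine le_antisymm ?_ ?_
    · linarith [hpot i, hmax₁ (Function.update θ i (ρ i))]
    · simpa only [hself] using (hbest i (S i)).1
  have hNash : IsBayesNash E S := fun i D => ((hbest i D).1).trans_eq (hreply i)
  refine ⟨S, ⟨hNash, ?_⟩, fun i => isThreshold_thresholdStrategy (θ i)⟩
  rintro i ⟨m, w, D', hw, hw1, hle, hlt⟩
  refine absurd (hF i (S i) m w D' hle hlt) (not_lt.2 ?_)
  have hsecond : ∑ T ∈ F i, expectedUtility E
      (Function.update T i (thresholdStrategy (ρ i))) i ≤
      ∑ T ∈ F i, expectedUtility E (Function.update T i (S i)) i := by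
    -- The modified profile also maximises the potential, so second-stage maximality applies, and
    -- the summands of the other voters cancel.
    have h := hmax₂ (Function.update θ i (ρ i)) (by linarith [hpot i, hreply i])
    rw [← hupd, ← Finset.add_sum_erase _ _ (Finset.mem_univ i),
      ← Finset.add_sum_erase _ _ (Finset.mem_univ i), Function.update_self] at h
    refine le_of_add_le_add_right (h.trans_eq (congrArg _ (Finset.sum_congr rfl fun j hj => ?_)))
    rw [Function.update_of_ne (Finset.ne_of_mem_erase hj)]
  -- Dominance tested at `S` itself: no component beats `S i` there, so each one of positive weight
  -- is a best reply.
  have hzero : ∀ k, w k * (expectedUtility E S i -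
      expectedUtility E (Function.update S i (D' k)) i) = 0 := by
    have hnn : ∀ k, 0 ≤ w k * (expectedUtility E S i -
        expectedUtility E (Function.update S i (D' k)) i) :=
      fun k => mul_nonneg (hw k) (sub_nonneg.2 (hNash i (D' k)))
    have hsum : ∑ k, w k * (expectedUtility E S i -
        expectedUtility E (Function.update S i (D' k)) i) ≤ 0 := by
      have := hle S
      rw [hself] at this
      simp only [mul_sub, Finset.sum_sub_distrib, ← Finset.sum_mul, hw1, one_mul]
      linarith
    intro k
    exact (Finset.sum_eq_zero_iff_of_nonneg fun k _ => hnn k).1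
      (le_antisymm hsum (Finset.sum_nonneg fun k _ => hnn k)) k (Finset.mem_univ k)
  have hterm : ∀ k, w k * ∑ T ∈ F i, expectedUtility E (Function.update T i (D' k)) i ≤
      w k * ∑ T ∈ F i, expectedUtility E (Function.update T i (S i)) i := by
    intro k
    rcases mul_eq_zero.1 (hzero k) with h | h
    · simp [h]
    · refine mul_le_mul_of_nonneg_left (((hbest i (D' k)).2 ?_).trans hsecond) (hw k)
      linarith [hreply i]
  refine (Finset.sum_le_sum fun k _ => hterm k).trans_eq ?_
  rw [← Finset.sum_mul, hw1, one_mul]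

end
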